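/- **Setting.** For $\lambda>0$ let $\mathbb A^{(\lambda)}$ be the Hilbert space of holomorphic functions on the unit disc $\mathbb D$ with reproducing kernel $(1-z\bar w)^{-2\lambda}$. Let $\eta>0$, $m\ge 0$, let $d_0,\dots,d_m\ge 1$ be integers, and let $Y$ be a block matrix on $\mathbb C^{d_0}\oplus\cdots\oplus\mathbb C^{d_m}$ whose only possibly non-zero blocks are the subdiagonal blocks $Y_j:\mathbb C^{d_{j-1}}\to\mathbb C^{d_j}$ ($1\le j\le m$). Put $\mathbf A^{(\eta)}=\bigoplus_{j=0}^m\mathbb A^{(\eta+j)}\otimes\mathbb C^{d_j}$ and, for $f=(f_0,\dots,f_m)\in\mathbf A^{(\eta)}$ and $0\le \ell\le m$, $$\big(\Gamma^{(\eta,Y)}f\big)_\ell=\sum_{j=0}^{\ell}\frac{1}{(\ell-j)!}\,\frac{1}{(2\eta+2j)_{\ell-j}}\;Y_\ell\cdots Y_{j+1}\,f_j^{(\ell-j)},\qquad (x)_k=x(x+1)\cdots(x+k-1).$$ The linear map $\Gamma^{(\eta,Y)}$ is injective. Let $\mathcal H_I^{(\eta,Y)}$ be its image, a space of functions $\mathbb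 D\to\mathbb C^{d_0}\oplus\cdots\oplus\mathbb C^{d_m}$, with the Hilbert space structure for which $\Gamma^{(\eta,Y)}$ is an isometry of $\mathbf A^{(\eta)}$ onto $\mathcal H_I^{(\eta,Y)}$. **Theorem.** Let $(\eta,m,(d_j)_{j=0}^m,Y)$ and $(\eta',m',(d'_j)_{j=0}^{m'},Y')$ be two sets of data as above. Multiplication by the coordinate, $(Mf)(z)=zf(z)$, defines bounded operators $M$ on $\mathcal H_I^{(\eta,Y)}$ and $M'$ on $\mathcal H_I^{(\eta',Y')}$. They are similar, that is, $LM=M'L$ for some bounded linear bijection $L:\mathcal H_I^{(\eta,Y)}\to\mathcal H_I^{(\eta',Y')}$ with bounded inverse, if and only if $\eta=\eta'$ and the blocks of $Y$ and $Y'$ have the same sizes, that is, $m=m'$ and $d_j=d'_j$ for $0\le j\le m$. -/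

import Mathlib

open scoped ComplexConjugate Complex.UnitDisc

noncomputable section

namespace HomogeneousOperators

/-- The kernel `(1 - z * conj w) ^ (-2 l)` on the unit disc (principal branch; `1 - z * conj w` has
positive real part), a complex number being identified with the operator of multiplication by it
on `ℂ`. -/
def bergmanKernel (l : ℝ) : Matrix 𝔻 𝔻 (ℂ →L[ℂ] ℂ) :=
  Matrix.of fun z w =>
    ((1 - (z : ℂ) * conj (w : ℂ)) ^ (-(2 * l : ℂ))) • ContinuousLinearMap.id ℂ ℂ

theorem norm_mul_conj_lt_one (z w : 𝔻) : ‖(z : ℂ) * conj (w : ℂ)‖ < 1 := by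
  rw [norm_mul, RCLike.norm_conj]
  exact mul_lt_one_of_nonneg_of_lt_one_left (norm_nonneg _) z.norm_lt_one w.norm_lt_one.le

/-- Binomial series with nonnegative coefficients. -/
theorem exists_hasSum_bergmanKernel {l : ℝ} (hl : 0 < l) :
    ∃ c : ℕ → ℝ, (∀ n, 0 ≤ c n) ∧ ∀ x : ℂ, ‖x‖ < 1 →
      HasSum (fun n => (c n : ℂ) * x ^ n) ((1 - x) ^ (-(2 * l : ℂ))) := by
  refine ⟨fun n => Ring.multichoose (2 * l) n, fun n => ?_, fun x hx => ?_⟩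
  · have h := Ring.factorial_nsmul_multichoose_eq_ascPochhammer (2 * l) n
    rw [Polynomial.ascPochhammer_smeval_eq_eval, nsmul_eq_mul] at h
    have h2 := ascPochhammer_pos n (2 * l) (by positivity)
    rw [← h] at h2
    exact (pos_of_mul_pos_right h2 (by positivity)).le
  · have h := (Complex.one_div_one_sub_cpow_hasFPowerSeriesOnBall_zero (2 * l)).hasSum
      (y := x) (by simpa [← ENNReal.ofReal_one, Metric.eball_ofReal] using hx)
    have e : ∀ n : ℕ, ((Ring.multichoose (2 * l) n : ℝ) : ℂ) =
        Ring.choose (2 * (l : ℂ) + n - 1) n := fun n => by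
      rw [← Ring.multichoose_eq]
      have := Ring.map_multichoose (Complex.ofRealHom) (2 * l) n
      simpa using this
    simp only [e]
    simpa [Complex.cpow_neg, FormalMultilinearSeries.ofScalars_apply_eq, mul_comm] using h

theorem bergmanKernel_posSemidef {l : ℝ} (hl : 0 < l) : (bergmanKernel l).PosSemidef := by
  obtain ⟨c, hc, hs⟩ := exists_hasSum_bergmanKernel hl
  have tfae := (RKHS.posSemidef_tfae (K := bergmanKernel l)).out 0 2
  refine tfae.mpr ⟨?_, fun v => ?_⟩
  · ext z w
    have h1 := hs _ (norm_mul_conj_lt_one z w)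
    have h2 := hs _ (norm_mul_conj_lt_one w z)
    have h3 := h2.star
    have : (fun n => star ((c n : ℂ) * ((w : ℂ) * conj (z : ℂ)) ^ n)) =
        fun n => (c n : ℂ) * ((z : ℂ) * conj (w : ℂ)) ^ n := by
      ext n; simp [mul_comm]
    rw [this] at h3
    have h4 := h1.unique h3
    simp only [Matrix.conjTranspose_apply, bergmanKernel, Matrix.of_apply, star_smul, ← h4]
    rw [← ContinuousLinearMap.one_def, star_one]
  · have key : HasSum (fun n : ℕ => (c n : ℂ) *
        ((v.sum fun x w => w * conj (x : ℂ) ^ n) * conj (v.sum fun x w => w * conj (x : ℂ) ^ n)))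
        (v.sum fun x w => v.sum fun x' w' => inner ℂ (bergmanKernel l x' x w) w') := by
      simp only [Finsupp.sum]
      have : (fun n : ℕ => (c n : ℂ) * ((∑ a ∈ v.support, v a * conj (a : ℂ) ^ n) *
          conj (∑ a ∈ v.support, v a * conj (a : ℂ) ^ n))) =
          fun n : ℕ => ∑ a ∈ v.support, ∑ b ∈ v.support,
            v b * conj (v a) * star ((c n : ℂ) * ((b : ℂ) * conj (a : ℂ)) ^ n) := by
        ext n
        rw [mul_comm (∑ a ∈ v.support, v a * conj (a : ℂ) ^ n), map_sum, Finset.sum_mul_sum,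
          Finset.mul_sum]
        refine Finset.sum_congr rfl fun a _ => ?_
        rw [Finset.mul_sum]
        refine Finset.sum_congr rfl fun b _ => ?_
        simp only [star_mul', map_mul, map_pow, RCLike.star_def, Complex.conj_ofReal,
          Complex.conj_conj, mul_pow, star_pow]
        ring
      rw [this]
      refine hasSum_sum fun a _ => hasSum_sum fun b _ => ?_
      have h := ((hs _ (norm_mul_conj_lt_one b a)).star).mul_left (v b * conj (v a))
      have e : inner ℂ (bergmanKernel l b a (v a)) (v b) = v b * conj (v a) *
          star ((1 - (b : ℂ) * conj (a : ℂ)) ^ (-(2 * l : ℂ))) := by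
        have e' : bergmanKernel l b a (v a) =
          (1 - (b : ℂ) * conj (a : ℂ)) ^ (-(2 * l : ℂ)) * v a := rfl
        rw [e', RCLike.inner_apply, map_mul, RCLike.star_def]
        ring
      rw [e]
      exact h
    have := (Complex.hasSum_re key).nonneg fun n => ?_
    · exact this
    · rw [Complex.mul_conj, ← Complex.ofReal_mul, Complex.ofReal_re]
      exact mul_nonneg (hc n) (Complex.normSq_nonneg _)

instance {l : ℝ} [Fact (0 < l)] : Fact (bergmanKernel l).PosSemidef :=
  ⟨bergmanKernel_posSemidef Fact.out⟩

/-- The weighted Bergman space `𝔸^(l)`: the Hilbert space of functions on the unit disc with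
reproducing kernel `(1 - z * conj w) ^ (-2 l)`. -/
def BergmanSpace (l : ℝ) [Fact (0 < l)] : Type := RKHS.OfKernel (bergmanKernel l)

namespace BergmanSpace

variable (l : ℝ) [Fact (0 < l)]

instance : NormedAddCommGroup (BergmanSpace l) :=
  inferInstanceAs (NormedAddCommGroup (RKHS.OfKernel (bergmanKernel l)))

instance : InnerProductSpace ℂ (BergmanSpace l) :=
  inferInstanceAs (InnerProductSpace ℂ (RKHS.OfKernel (bergmanKernel l)))

instance : CompleteSpace (BergmanSpace l) :=
  inferInstanceAs (CompleteSpace (RKHS.OfKernel (bergmanKernel l)))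

instance : RKHS ℂ (BergmanSpace l) 𝔻 ℂ :=
  inferInstanceAs (RKHS ℂ (RKHS.OfKernel (bergmanKernel l)) 𝔻 ℂ)

theorem kernel_eq : RKHS.kernel (BergmanSpace l) = bergmanKernel l :=
  RKHS.OfKernel.kernel_ofKernel (K := bergmanKernel l)

end BergmanSpace

/-- Extension of a function on the disc by zero, used to form complex derivatives at points of the
(open) disc. -/
def extendDisc (f : 𝔻 → ℂ) : ℂ → ℂ := Function.extend (fun z : 𝔻 => (z : ℂ)) f 0

theorem extendDisc_coe (f : 𝔻 → ℂ) (z : 𝔻) : extendDisc f z = f z :=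
  Complex.UnitDisc.coe_injective.extend_apply f 0 z

theorem extendDisc_add (f g : 𝔻 → ℂ) : extendDisc (f + g) = extendDisc f + extendDisc g := by
  have h := Function.extend_add (fun z : 𝔻 => (z : ℂ)) f g 0 0
  rwa [add_zero] at h

theorem extendDisc_smul (c : ℂ) (f : 𝔻 → ℂ) : extendDisc (c • f) = c • extendDisc f := by
  have h := Function.extend_smul c (fun z : 𝔻 => (z : ℂ)) f 0
  rwa [smul_zero] at h

theorem extendDisc_zero : extendDisc 0 = 0 := by
  simpa using extendDisc_smul 0 0

theorem BergmanSpace.norm_kerFun_le {l : ℝ} [Fact (0 < l)] {r : ℝ} (hr : r < 1) (z : 𝔻)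
    (hz : ‖(z : ℂ)‖ ≤ r) :
    ‖RKHS.kerFun (BergmanSpace l) z‖ ≤ √((1 - r ^ 2) ^ (-(2 * l))) := by
  have hl : 0 < l := Fact.out
  have hr0 : 0 ≤ r := (norm_nonneg _).trans hz
  rw [RKHS.norm_kerFun_eq_sqrt_norm_kernel, BergmanSpace.kernel_eq]
  apply Real.sqrt_le_sqrt
  have h1 : 0 < 1 - r ^ 2 := by nlinarith
  have h2 : ‖(z : ℂ)‖ ^ 2 ≤ r ^ 2 := by gcongr
  have h3 : (1 : ℂ) - (z : ℂ) * conj (z : ℂ) = ((1 - ‖(z : ℂ)‖ ^ 2 : ℝ) : ℂ) := by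
    rw [Complex.mul_conj, Complex.normSq_eq_norm_sq]; push_cast; ring
  have h4 : ‖((1 : ℂ) - (z : ℂ) * conj (z : ℂ)) ^ (-(2 * l : ℂ))‖ =
      (1 - ‖(z : ℂ)‖ ^ 2) ^ (-(2 * l)) := by
    rw [h3, show (-(2 * l : ℂ)) = ((-(2 * l) : ℝ) : ℂ) by push_cast; ring,
      Complex.norm_cpow_eq_rpow_re_of_pos (by linarith), Complex.ofReal_re]
  have h5 : bergmanKernel l z z =
    (((1 : ℂ) - (z : ℂ) * conj (z : ℂ)) ^ (-(2 * l : ℂ))) • ContinuousLinearMap.id ℂ ℂ := rfl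
  rw [h5, norm_smul, h4, ContinuousLinearMap.norm_id, mul_one]
  exact Real.rpow_le_rpow_of_nonpos h1 (by linarith) (by linarith)

theorem BergmanSpace.differentiableOn_kerFun {l : ℝ} [Fact (0 < l)] (w : 𝔻) (v : ℂ) :
    DifferentiableOn ℂ (extendDisc (RKHS.kerFun (BergmanSpace l) w v)) (Metric.ball 0 1) := by
  have h : DifferentiableOn ℂ
      (fun z : ℂ => (1 - z * conj (w : ℂ)) ^ (-(2 * l : ℂ)) * v) (Metric.ball 0 1) := by
    intro z hz
    refine (DifferentiableAt.mul_const (DifferentiableAt.cpow (by fun_prop) (by fun_prop) ?_)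
      v).differentiableWithinAt
    have h1 := norm_mul_conj_lt_one (.mk z (by simpa using hz)) w
    have h2 := Complex.mem_slitPlane_of_norm_lt_one (z := -(z * conj (w : ℂ)))
      (by rw [norm_neg]; exact h1)
    rwa [← sub_eq_add_neg] at h2
  refine h.congr fun z hz => ?_
  obtain ⟨z, rfl⟩ : ∃ z' : 𝔻, (z' : ℂ) = z := ⟨.mk z (by simpa using hz), rfl⟩
  rw [extendDisc_coe, RKHS.kerFun_apply, BergmanSpace.kernel_eq]
  simp [bergmanKernel]

/-- The elements of `𝔸^(l)` are holomorphic. -/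
theorem BergmanSpace.differentiableOn {l : ℝ} [Fact (0 < l)] (f : BergmanSpace l) :
    DifferentiableOn ℂ (extendDisc f) (Metric.ball 0 1) := by
  have hd := RKHS.kerFun_dense (BergmanSpace l)
  have hf : f ∈ closure
      (Submodule.span ℂ {RKHS.kerFun (BergmanSpace l) x v | (x) (v)} : Set (BergmanSpace l)) := by
    rw [← Submodule.topologicalClosure_coe, hd]; trivial
  obtain ⟨u, hu, hlim⟩ := mem_closure_iff_seq_limit.mp hf
  have hu' : ∀ n, DifferentiableOn ℂ (extendDisc (u n)) (Metric.ball 0 1) := fun n => by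
    refine Submodule.span_induction (p := fun g _ =>
      DifferentiableOn ℂ (extendDisc (g : BergmanSpace l)) (Metric.ball 0 1)) ?_ ?_ ?_ ?_ (hu n)
    · rintro _ ⟨w, v, rfl⟩
      exact BergmanSpace.differentiableOn_kerFun w v
    · rw [RKHS.coe_zero, extendDisc_zero]; exact differentiableOn_const 0
    · intro a b _ _ ha hb
      rw [RKHS.coe_add, extendDisc_add]; exact ha.add hb
    · intro c a _ ha
      rw [RKHS.coe_smul, extendDisc_smul]; exact ha.const_smul c
  refine TendstoLocallyUniformlyOn.differentiableOn (F := fun n => extendDisc (u n))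
    (φ := Filter.atTop) ?_ (Filter.Eventually.of_forall hu') Metric.isOpen_ball
  rw [tendstoLocallyUniformlyOn_iff_forall_isCompact Metric.isOpen_ball]
  intro K hK hKc
  obtain ⟨r, hr, hKr⟩ : ∃ r < 1, ∀ z ∈ K, ‖z‖ ≤ r := by
    rcases K.eq_empty_or_nonempty with rfl | hne
    · exact ⟨0, zero_lt_one, by simp⟩
    · obtain ⟨z0, hz0, hmax⟩ := hKc.exists_isMaxOn hne continuous_norm.continuousOn
      exact ⟨‖z0‖, by simpa using hK hz0, fun z hz => hmax hz⟩
  have key := RKHS.tendstoUniformlyOn_of_norm_kerFun_le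
    (s := {z : 𝔻 | ‖(z : ℂ)‖ ≤ r})
    (fun z hz => BergmanSpace.norm_kerFun_le (l := l) hr z hz) hlim
  rw [Metric.tendstoUniformlyOn_iff] at key ⊢
  intro ε hε
  filter_upwards [key ε hε] with n hn z hz
  obtain ⟨z, rfl⟩ : ∃ z' : 𝔻, (z' : ℂ) = z := ⟨.mk z (by simpa using hK hz), rfl⟩
  rw [extendDisc_coe, extendDisc_coe]
  exact hn z (hKr _ hz)

theorem BergmanSpace.contDiffAt {l : ℝ} [Fact (0 < l)] (f : BergmanSpace l) (z : 𝔻) (n : ℕ) :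
    ContDiffAt ℂ n (extendDisc f) (z : ℂ) :=
  (f.differentiableOn.analyticAt
    (Metric.isOpen_ball.mem_nhds (by simpa using z.norm_lt_one))).contDiffAt

instance {l : ℝ} [h : Fact (0 < l)] (j : ℕ) : Fact (0 < l + j) :=
  ⟨add_pos_of_pos_of_nonneg h.out j.cast_nonneg⟩

/-- Indices of the coordinates of `ℂ^{d_0} ⊕ ⋯ ⊕ ℂ^{d_m}`: pairs of a block number `j` and a place
inside the block `j`. -/
abbrev BlockIndex {m : ℕ} (d : Fin (m + 1) → ℕ) : Type := Σ j : Fin (m + 1), Fin (d j)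

/-- `Y` consists of blocks `Y_j : ℂ^{d_{j-1}} → ℂ^{d_j}`, `1 ≤ j ≤ m`, directly below the block
diagonal, and of zeros elsewhere. -/
def IsBlockSubdiagonal {m : ℕ} {d : Fin (m + 1) → ℕ}
    (Y : Matrix (BlockIndex d) (BlockIndex d) ℂ) : Prop :=
  ∀ p q : BlockIndex d, (p.1 : ℕ) ≠ q.1 + 1 → Y p q = 0

section

variable (η : ℝ) [Fact (0 < η)] {m : ℕ} {d : Fin (m + 1) → ℕ}
  (Y : Matrix (BlockIndex d) (BlockIndex d) ℂ)

variable (d) in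
/-- The Hilbert space `𝐀^(η) = ⊕_j 𝔸^(η+j) ⊗ ℂ^{d_j}`: families of components, the component at
`(j, q)` lying in `𝔸^(η+j)`. -/
abbrev SumBergmanSpace : Type :=
  PiLp 2 fun p : BlockIndex d => BergmanSpace (η + ((p.1 : ℕ) : ℝ))

/-- The function `Γ^(η,Y) f` on the disc. Its `ℓ`-th block is
`∑_{j ≤ ℓ} 1 / ((ℓ-j)! (2η+2j)_{ℓ-j}) Y_ℓ ⋯ Y_{j+1} f_j^{(ℓ-j)}`, where `(x)_k = x (x+1) ⋯ (x+k-1)`.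
For block subdiagonal `Y` the product `Y_ℓ ⋯ Y_{j+1}` is the `(ℓ, j)` block of `Y ^ (ℓ-j)`
(the identity for `ℓ = j`). -/
def gammaFun (f : SumBergmanSpace η d) (z : 𝔻) : EuclideanSpace ℂ (BlockIndex d) :=
  WithLp.toLp 2 fun p => ∑ q : BlockIndex d,
    if q.1 ≤ p.1 then
      (1 / (((p.1 : ℕ) - (q.1 : ℕ)).factorial : ℂ)) *
        (1 / (ascPochhammer ℂ ((p.1 : ℕ) - (q.1 : ℕ))).eval (2 * (η : ℂ) + 2 * ((q.1 : ℕ) : ℂ))) *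
        (Y ^ ((p.1 : ℕ) - (q.1 : ℕ))) p q *
        iteratedDeriv ((p.1 : ℕ) - (q.1 : ℕ)) (extendDisc (f q)) (z : ℂ)
    else 0

/-- `Γ^(η,Y)` as a linear map from `𝐀^(η)` to functions on the disc. -/
def gamma : SumBergmanSpace η d →ₗ[ℂ] (𝔻 → EuclideanSpace ℂ (BlockIndex d)) where
  toFun := gammaFun η Y
  map_add' f g := by
    funext z
    ext p
    simp only [gammaFun, Pi.add_apply, PiLp.add_apply, ← Finset.sum_add_distrib]
    refine Finset.sum_congr rfl fun q _ => ?_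
    split_ifs
    · rw [RKHS.coe_add, extendDisc_add, iteratedDeriv_add (BergmanSpace.contDiffAt _ _ _)
        (BergmanSpace.contDiffAt _ _ _)]
      ring
    · simp
  map_smul' c f := by
    funext z
    ext p
    simp only [gammaFun, Pi.smul_apply, PiLp.smul_apply, RingHom.id_apply, Finset.smul_sum]
    refine Finset.sum_congr rfl fun q _ => ?_
    split_ifs
    · rw [RKHS.coe_smul, extendDisc_smul, iteratedDeriv_const_smul
        (BergmanSpace.contDiffAt _ _ _)]
      simp only [smul_eq_mul]
      ring
    · simp

theorem gamma_injective : Function.Injective (gamma η Y) := by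
  rw [← LinearMap.ker_eq_bot, LinearMap.ker_eq_bot']
  intro f hf
  have main : ∀ n : ℕ, ∀ p : BlockIndex d, (p.1 : ℕ) = n → f p = 0 := by
    intro n
    induction n using Nat.strong_induction_on with
    | _ n ih =>
      rintro p rfl
      refine RKHS.ext fun z => ?_
      have h : gammaFun η Y f z p = 0 := by
        have := congrFun hf z
        rw [show gammaFun η Y f z = 0 from this]; rfl
      rw [show gammaFun η Y f z p = _ from Finset.sum_eq_single p ?_ ?_] at h
      · simpa [extendDisc_coe] using h
      · intro q _ hq
        split_ifs with hle
        · rcases hle.lt_or_eq with hlt | heq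
          · rw [ih _ hlt q rfl, RKHS.coe_zero, extendDisc_zero]
            simp
          · have h0 : (p.1 : ℕ) - (q.1 : ℕ) = 0 := by rw [heq, Nat.sub_self]
            rw [h0, pow_zero, Matrix.one_apply_ne hq.symm]
            simp
        · rfl
      · simp
  ext1 p
  exact main _ p rfl

/-- The space `H_I^(η,Y)` of functions on the disc with values in `ℂ^{d_0} ⊕ ⋯ ⊕ ℂ^{d_m}`: the image
of `Γ^(η,Y)`, with the Hilbert space structure that makes `Γ^(η,Y)` isometric. -/
def SectionSpace : Type := ↥(LinearMap.range (gamma η Y))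

namespace SectionSpace

instance : AddCommGroup (SectionSpace η Y) :=
  inferInstanceAs (AddCommGroup ↥(LinearMap.range (gamma η Y)))

instance : Module ℂ (SectionSpace η Y) :=
  inferInstanceAs (Module ℂ ↥(LinearMap.range (gamma η Y)))

instance : CoeFun (SectionSpace η Y) fun _ => 𝔻 → EuclideanSpace ℂ (BlockIndex d) :=
  ⟨fun f => f.1⟩

/-- `Γ^(η,Y)` as a linear bijection of `𝐀^(η)` onto its image. -/
def equiv : SumBergmanSpace η d ≃ₗ[ℂ] SectionSpace η Y :=
  LinearEquiv.ofInjective (gamma η Y) (gamma_injective η Y)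

instance : NormedAddCommGroup (SectionSpace η Y) :=
  NormedAddCommGroup.induced _ _ (equiv η Y).symm (equiv η Y).symm.injective

instance : InnerProductSpace ℂ (SectionSpace η Y) where
  norm_smul_le c f := by
    change ‖(equiv η Y).symm (c • f)‖ ≤ ‖c‖ * ‖(equiv η Y).symm f‖
    rw [map_smul]; exact norm_smul_le _ _
  inner f g := inner ℂ ((equiv η Y).symm f) ((equiv η Y).symm g)
  norm_sq_eq_re_inner f := norm_sq_eq_re_inner (𝕜 := ℂ) ((equiv η Y).symm f)
  conj_inner_symm f g := inner_conj_symm ((equiv η Y).symm f) ((equiv η Y).symm g)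
  add_left f g h := by rw [map_add]; exact inner_add_left _ _ _
  smul_left f g c := by rw [map_smul]; exact inner_smul_left _ _ _

/-- `Γ^(η,Y)` as an isometry of `𝐀^(η)` onto `H_I^(η,Y)`. -/
def isometryEquiv : SumBergmanSpace η d ≃ₗᵢ[ℂ] SectionSpace η Y where
  __ := equiv η Y
  norm_map' f := by
    change ‖(equiv η Y).symm (equiv η Y f)‖ = ‖f‖
    rw [LinearEquiv.symm_apply_apply]

instance : CompleteSpace (SectionSpace η Y) :=
  (isometryEquiv η Y).toIsometryEquiv.symm.completeSpace

variable {η Y} in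
/-- `M` is the operator `(M f)(z) = z f(z)`. -/
def IsMulOp (M : SectionSpace η Y →L[ℂ] SectionSpace η Y) : Prop :=
  ∀ (f : SectionSpace η Y) (z : 𝔻), M f z = (z : ℂ) • f z

end SectionSpace

end

/-- Similarity of bounded operators: `L S = T L` for a bounded `L` with bounded inverse. -/
def AreSimilar {H K : Type*} [NormedAddCommGroup H] [NormedSpace ℂ H]
    [NormedAddCommGroup K] [NormedSpace ℂ K] (S : H →L[ℂ] H) (T : K →L[ℂ] K) : Prop :=
  ∃ L : H ≃L[ℂ] K, ∀ x : H, L (S x) = T (L x)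

end HomogeneousOperators

end

open HomogeneousOperators

/-!
The parameter `l` governs `𝔸^(l)` only through the weights of its Taylor coefficients: if
`c_n = (2l)_n / n!`, then `‖f‖² = ∑ |a_n|² / c_n` for `f = ∑ a_n z ^ n`, and every sequence with a
finite sum occurs (`BergmanSpace.hasSum_norm_coeff`, `BergmanSpace.exists_coeff_eq`). This comes from
comparing `𝔸^(l)` with `ℓ²`, where the vectors `(√c_n (conj w) ^ n)_n` have the same Gram matrix as
the kernel functions.

*The matrix `Y` plays no role up to similarity.* The weights show that the `k`-th derivative is
bounded from `𝔸^(l)` to `𝔸^(l+k)` (`BergmanSpace.exists_iteratedDerivOp`). Therefore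
`f_j^(ℓ-j)` belongs to `𝔸^(η+ℓ)` for `f_j ∈ 𝔸^(η+j)`, and `Γ^(η,Y)` is a bounded operator of `𝐀^(η)`
into itself, of the form `1 + N` with `N` strictly lower triangular, hence nilpotent. So it is
invertible there: `H_I^(η,Y)` and `𝐀^(η)` are the same space of functions with equivalent norms
(`exists_sectionSpace_equiv`), and `M` is similar to the direct sum of the multiplications on the
components of `𝐀^(η)`.

*The parameters are similarity invariants.* Let `L` be an invertible operator from `𝐀^(η)` to
`𝐀^(η')` that commutes with multiplication by `z`. The map `v ↦ (L v)(0)` on constant functions is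
injective, because the functions vanishing at `0` are exactly the multiples of `z`
(`symbolZero_injective`). Its entry from a component `𝔸^(l)` to a component `𝔸^(l')` with `l' < l` is
zero: comparison of `L (z ^ n)` with `z ^ n` bounds the square of its modulus by a multiple of the
ratio of the weights, which tends to `0` (`symbolZero_single_eq_zero`). An injective matrix with this
triangular shape shows that for each `t` the number of components of parameter at least `t` does not
decrease from `𝐀^(η)` to `𝐀^(η')`. By symmetry the multisets of parameters `η + j`, taken `d_j`
times, coincide, and they determine `η`, `m` and the `d_j`.
-/

namespace HomogeneousOperators

/-! ### Hilbert spaces spanned by families with equal Gram matrices -/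

section Gram

variable {X H K : Type*} [NormedAddCommGroup H] [InnerProductSpace ℂ H] [CompleteSpace H]
  [NormedAddCommGroup K] [InnerProductSpace ℂ K] [CompleteSpace K]

theorem denseRange_linearCombination {φ : X → H} (hφ : ∀ x, (∀ w, inner ℂ (φ w) x = 0) → x = 0) :
    DenseRange (Finsupp.linearCombination ℂ φ) := by
  have h : (Submodule.span ℂ (Set.range φ)).topologicalClosure = ⊤ := by
    rw [Submodule.topologicalClosure_eq_top_iff, Submodule.eq_bot_iff]
    intro x hx
    exact hφ x fun w => hx _ (Submodule.subset_span ⟨w, rfl⟩)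
  rw [← Submodule.dense_iff_topologicalClosure_eq_top, ← Finsupp.range_linearCombination] at h
  exact h

/-- Two Hilbert spaces with total families that have the same Gram matrix are isometric, by an
isometry that carries one family to the other. -/
theorem exists_linearIsometryEquiv_of_inner_eq {φ : X → H} {ψ : X → K}
    (hφ : ∀ x, (∀ w, inner ℂ (φ w) x = 0) → x = 0)
    (hψ : ∀ x, (∀ w, inner ℂ (ψ w) x = 0) → x = 0)
    (h : ∀ z w, inner ℂ (φ z) (φ w) = inner ℂ (ψ z) (ψ w)) :
    ∃ U : H ≃ₗᵢ[ℂ] K, ∀ w, U (φ w) = ψ w := by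
  have hn : ∀ v : X →₀ ℂ, ‖Finsupp.linearCombination ℂ ψ (LinearEquiv.refl ℂ (X →₀ ℂ) v)‖ =
      ‖Finsupp.linearCombination ℂ φ v‖ := by
    intro v
    rw [LinearEquiv.refl_apply, @norm_eq_sqrt_re_inner ℂ, @norm_eq_sqrt_re_inner ℂ]
    congr 2
    simp only [Finsupp.linearCombination_apply, Finsupp.sum, sum_inner, inner_sum,
      inner_smul_left, inner_smul_right, h]
  refine ⟨LinearEquiv.extendOfIsometry (LinearEquiv.refl ℂ (X →₀ ℂ)) _ _
    (denseRange_linearCombination hφ) (denseRange_linearCombination hψ) hn, fun w => ?_⟩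
  have := LinearEquiv.extendOfIsometry_eq (LinearEquiv.refl ℂ (X →₀ ℂ)) _ _
    (denseRange_linearCombination hφ) (denseRange_linearCombination hψ) hn (Finsupp.single w 1)
  simpa using this

end Gram

/-! ### The coefficients of the kernel -/

/-- The `n`-th Taylor coefficient `(2l)_n / n!` of `(1 - x) ^ (-2 l)`. -/
noncomputable def kernelCoeff (l : ℝ) (n : ℕ) : ℝ :=
  (ascPochhammer ℝ n).eval (2 * l) / n.factorial

theorem kernelCoeff_zero (l : ℝ) : kernelCoeff l 0 = 1 := by simp [kernelCoeff]

theorem kernelCoeff_pos {l : ℝ} (hl : 0 < l) (n : ℕ) : 0 < kernelCoeff l n :=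
  div_pos (ascPochhammer_pos n _ (by positivity)) (by positivity)

theorem kernelCoeff_succ (l : ℝ) (n : ℕ) :
    (n + 1) * kernelCoeff l (n + 1) = (2 * l + n) * kernelCoeff l n := by
  rw [kernelCoeff, kernelCoeff, ascPochhammer_succ_eval, Nat.factorial_succ]
  push_cast
  field_simp

theorem kernelCoeff_eq_multichoose (l : ℝ) (n : ℕ) :
    kernelCoeff l n = Ring.multichoose (2 * l) n := by
  have h := Ring.factorial_nsmul_multichoose_eq_ascPochhammer (2 * l) n
  rw [Polynomial.ascPochhammer_smeval_eq_eval, nsmul_eq_mul] at h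
  rw [kernelCoeff, ← h]
  field_simp

theorem hasSum_kernelCoeff (l : ℝ) {x : ℂ} (hx : ‖x‖ < 1) :
    HasSum (fun n => (kernelCoeff l n : ℂ) * x ^ n) ((1 - x) ^ (-(2 * l : ℂ))) := by
  have h := (Complex.one_div_one_sub_cpow_hasFPowerSeriesOnBall_zero (2 * l)).hasSum
    (y := x) (by simpa [← ENNReal.ofReal_one, Metric.eball_ofReal] using hx)
  have e : ∀ n : ℕ, (kernelCoeff l n : ℂ) = Ring.choose (2 * (l : ℂ) + n - 1) n := fun n => by
    rw [kernelCoeff_eq_multichoose, ← Ring.multichoose_eq]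
    simpa using Ring.map_multichoose Complex.ofRealHom (2 * l) n
  simp only [e]
  simpa [Complex.cpow_neg, FormalMultilinearSeries.ofScalars_apply_eq, mul_comm] using h

theorem kernelCoeff_succ_le {l : ℝ} (hl : 0 < l) (n : ℕ) :
    kernelCoeff l (n + 1) ≤ max 1 (2 * l) * kernelCoeff l n := by
  have h := kernelCoeff_succ l n
  have hn : (0 : ℝ) < n + 1 := by positivity
  refine le_of_mul_le_mul_left ?_ hn
  rw [h, ← mul_assoc]
  refine mul_le_mul_of_nonneg_right ?_ (kernelCoeff_pos hl n).le
  nlinarith [le_max_left 1 (2 * l), le_max_right 1 (2 * l), (n.cast_nonneg : (0 : ℝ) ≤ n)]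

theorem kernelCoeff_le_succ {l : ℝ} (hl : 0 < l) (n : ℕ) :
    kernelCoeff l n ≤ max 1 (1 / (2 * l)) * kernelCoeff l (n + 1) := by
  have h := kernelCoeff_succ l n
  have hn : (0 : ℝ) < 2 * l + n := by positivity
  refine le_of_mul_le_mul_left ?_ hn
  rw [← h, ← mul_assoc]
  refine mul_le_mul_of_nonneg_right ?_ (kernelCoeff_pos hl _).le
  have h1 : 1 ≤ 2 * l * max 1 (1 / (2 * l)) := by
    calc 1 = 2 * l * (1 / (2 * l)) := by field_simp
      _ ≤ _ := by gcongr; exact le_max_right _ _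
  nlinarith [le_max_left 1 (1 / (2 * l)), (n.cast_nonneg : (0 : ℝ) ≤ n)]

/-- The weights of `𝔸^(l)` and `𝔸^(l+1)` at the two ends of the differentiation operator. -/
theorem mul_kernelCoeff_succ_eq (l : ℝ) (n : ℕ) :
    (n + 1) * (2 * l + n + 1) * kernelCoeff l (n + 1) =
      2 * l * (2 * l + 1) * kernelCoeff (l + 1) n := by
  induction n with
  | zero =>
    have h := kernelCoeff_succ l 0
    rw [kernelCoeff_zero] at *
    simp only [Nat.cast_zero] at *
    linear_combination (2 * l + 1) * h
  | succ n ih =>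
    have h1 := kernelCoeff_succ l (n + 1)
    have h2 := kernelCoeff_succ (l + 1) n
    have hn : ((n : ℝ) + 1) ≠ 0 := by positivity
    apply mul_left_cancel₀ hn
    push_cast at *
    linear_combination (n + 1) * (2 * l + n + 2) * h1 + (2 * l + n + 2) * ih
      - 2 * l * (2 * l + 1) * h2

theorem sq_mul_kernelCoeff_succ_le {l : ℝ} (hl : 0 < l) (n : ℕ) :
    ((n : ℝ) + 1) ^ 2 * kernelCoeff l (n + 1) ≤
      2 * l * (2 * l + 1) * kernelCoeff (l + 1) n := by
  rw [← mul_kernelCoeff_succ_eq]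
  refine mul_le_mul_of_nonneg_right ?_ (kernelCoeff_pos hl _).le
  have : (0 : ℝ) < n + 1 := by positivity
  nlinarith

/-- The smaller the parameter, the slower the kernel coefficients grow: this is what separates the
shifts on two Bergman spaces. -/
theorem tendsto_kernelCoeff_div {l l' : ℝ} (hl : 0 < l) (hl' : 0 < l') (h : l' < l) :
    Filter.Tendsto (fun n => kernelCoeff l' (n + 1) / kernelCoeff l (n + 1)) Filter.atTop
      (nhds 0) := by
  have h1 := (Real.GammaSeq_tendsto_Gamma (2 * l)).div (Real.GammaSeq_tendsto_Gamma (2 * l'))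
    (Real.Gamma_pos_of_pos (by positivity)).ne'
  have h2 : Filter.Tendsto (fun n : ℕ => (n : ℝ) ^ (-(2 * (l - l')))) Filter.atTop (nhds 0) :=
    (tendsto_rpow_neg_atTop (by linarith)).comp tendsto_natCast_atTop_atTop
  have h3 := h1.mul h2
  rw [mul_zero] at h3
  refine h3.congr' ?_
  filter_upwards [Filter.eventually_gt_atTop 0] with n hn
  have e : ∀ l : ℝ, (ascPochhammer ℝ (n + 1)).eval (2 * l) =
      ∏ j ∈ Finset.range (n + 1), (2 * l + j) := fun l => by
    induction n + 1 with
    | zero => simp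
    | succ k ih => rw [ascPochhammer_succ_eval, ih, Finset.prod_range_succ]
  have hp : ∀ l : ℝ, 0 < l → 0 < ∏ j ∈ Finset.range (n + 1), (2 * l + (j : ℝ)) := fun l hl =>
    Finset.prod_pos fun j _ => by positivity
  have hn' : (0 : ℝ) < n := by exact_mod_cast hn
  simp only [Pi.div_apply, Real.GammaSeq, kernelCoeff, e]
  have := hp l hl
  have := hp l' hl'
  rw [show (-(2 * (l - l'))) = 2 * l' - 2 * l by ring, Real.rpow_sub hn']
  have := Real.rpow_pos_of_pos hn' (2 * l)
  have := Real.rpow_pos_of_pos hn' (2 * l')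
  field_simp

/-! ### Taylor coefficients in the Bergman spaces -/

/-- A power series that vanishes on the unit disc has vanishing coefficients. -/
theorem eq_zero_of_hasSum_pow {a : ℕ → ℂ} (h : ∀ z : 𝔻, HasSum (fun n => a n * (z : ℂ) ^ n) 0) :
    a = 0 := by
  have hp : HasFPowerSeriesAt (0 : ℂ → ℂ) (FormalMultilinearSeries.ofScalars ℂ a) 0 := by
    rw [hasFPowerSeriesAt_iff]
    filter_upwards [Metric.ball_mem_nhds (0 : ℂ) one_pos] with z hz
    have := h (.mk z (by simpa using hz))
    simpa [FormalMultilinearSeries.coeff_ofScalars, mul_comm] using this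
  have := hp.eq_zero
  funext n
  have h2 := congrArg (fun p : FormalMultilinearSeries ℂ ℂ ℂ => p.coeff n) this
  rw [FormalMultilinearSeries.coeff_ofScalars] at h2
  exact h2

namespace BergmanSpace

variable (l : ℝ) [Fact (0 < l)]

/-- The sequence `(√c_n (conj w) ^ n)_n` in `ℓ²`, where `c_n` are the kernel coefficients. Its Gram
matrix is the kernel of `𝔸^(l)`. -/
noncomputable def feature (w : 𝔻) : lp (fun _ : ℕ => ℂ) 2 :=
  ⟨fun n => (√(kernelCoeff l n) : ℂ) * conj (w : ℂ) ^ n, by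
    have h := (hasSum_kernelCoeff l (norm_mul_conj_lt_one w w)).summable.norm
    refine (memℓp_gen_iff (by simp)).2 (h.congr fun n => ?_)
    have hc := (kernelCoeff_pos (Fact.out : 0 < l) n).le
    simp only [norm_mul, norm_pow, RCLike.norm_conj, Complex.norm_real, Real.norm_eq_abs,
      abs_of_nonneg hc, abs_of_nonneg (Real.sqrt_nonneg _), ENNReal.toReal_ofNat, Real.rpow_two,
      mul_pow, Real.sq_sqrt hc]
    ring⟩

theorem hasSum_inner_feature (w : 𝔻) (x : lp (fun _ : ℕ => ℂ) 2) :
    HasSum (fun n => (√(kernelCoeff l n) : ℂ) * x n * (w : ℂ) ^ n)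
      (inner ℂ (feature l w) x) := by
  refine (lp.hasSum_inner (𝕜 := ℂ) (feature l w) x).congr_fun fun n => ?_
  simp only [feature, RCLike.inner_apply, map_mul, map_pow, Complex.conj_ofReal,
    Complex.conj_conj]
  ring

theorem exists_isometry_lp : ∃ U : BergmanSpace l ≃ₗᵢ[ℂ] lp (fun _ : ℕ => ℂ) 2,
    ∀ w, U (RKHS.kerFun (BergmanSpace l) w 1) = feature l w := by
  refine exists_linearIsometryEquiv_of_inner_eq (fun f hf => ?_) (fun x hx => ?_) fun z w => ?_
  · ext w
    simpa using hf w
  · have h := eq_zero_of_hasSum_pow (a := fun n => (√(kernelCoeff l n) : ℂ) * x n) fun w => by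
      rw [← hx w]; exact hasSum_inner_feature l w x
    ext n
    have := congrFun h n
    have hc := (Real.sqrt_pos.mpr (kernelCoeff_pos (Fact.out : 0 < l) n)).ne'
    simpa [hc] using this
  · rw [RKHS.kerFun_inner, RKHS.kerFun_apply, kernel_eq]
    have h1 := hasSum_inner_feature l z (feature l w)
    have h2 := hasSum_kernelCoeff l (norm_mul_conj_lt_one z w)
    have h3 := h2.unique (h1.congr_fun fun n => ?_)
    · simpa [bergmanKernel] using h3
    · have hc := (kernelCoeff_pos (Fact.out : 0 < l) n).le
      simp only [feature]
      rw [← mul_assoc, ← Complex.ofReal_mul, Real.mul_self_sqrt hc]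
      ring

/-- An isometry of `𝔸^(l)` onto `ℓ²`: the coordinates in the orthonormal basis `√c_n z ^ n`. -/
noncomputable def isometryLp : BergmanSpace l ≃ₗᵢ[ℂ] lp (fun _ : ℕ => ℂ) 2 :=
  (exists_isometry_lp l).choose

variable {l}

/-- The `n`-th Taylor coefficient at `0` of an element of `𝔸^(l)`. -/
noncomputable def coeff (f : BergmanSpace l) (n : ℕ) : ℂ :=
  (√(kernelCoeff l n) : ℂ) * isometryLp l f n

theorem hasSum_coeff (f : BergmanSpace l) (z : 𝔻) :
    HasSum (fun n => coeff f n * (z : ℂ) ^ n) (f z) := by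
  have h := hasSum_inner_feature l z (isometryLp l f)
  rw [← (exists_isometry_lp l).choose_spec z] at h
  have e : inner ℂ (isometryLp l (RKHS.kerFun (BergmanSpace l) z 1)) (isometryLp l f) = f z := by
    rw [LinearIsometryEquiv.inner_map_map]; simp
  rw [← e]
  exact h

theorem coeff_zero_eq (f : BergmanSpace l) : coeff f 0 = f 0 := by
  have h := hasSum_coeff f 0
  refine (h.unique ?_).symm
  have := hasSum_single (f := fun n => coeff f n * ((0 : 𝔻) : ℂ) ^ n) 0 fun n hn => by simp [hn]
  simpa using this

/-- The norm of `𝔸^(l)` in terms of Taylor coefficients. -/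
theorem hasSum_norm_coeff (f : BergmanSpace l) :
    HasSum (fun n => ‖coeff f n‖ ^ 2 / kernelCoeff l n) (‖f‖ ^ 2) := by
  have h := lp.hasSum_norm (p := 2) (by simp) (isometryLp l f)
  rw [LinearIsometryEquiv.norm_map] at h
  simp only [ENNReal.toReal_ofNat, Real.rpow_two] at h
  refine h.congr_fun fun n => ?_
  have hc := kernelCoeff_pos (Fact.out : 0 < l) n
  rw [coeff, norm_mul, mul_pow, Complex.norm_real, Real.norm_eq_abs, sq_abs, Real.sq_sqrt hc.le]
  field_simp

theorem norm_coeff_sq_le (f : BergmanSpace l) (n : ℕ) :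
    ‖coeff f n‖ ^ 2 / kernelCoeff l n ≤ ‖f‖ ^ 2 :=
  le_hasSum (hasSum_norm_coeff f) n fun k _ =>
    div_nonneg (sq_nonneg _) (kernelCoeff_pos (Fact.out : 0 < l) k).le

theorem exists_coeff_eq {a : ℕ → ℂ} (ha : Summable fun n => ‖a n‖ ^ 2 / kernelCoeff l n) :
    ∃ f : BergmanSpace l, coeff f = a := by
  have hc := fun n => kernelCoeff_pos (Fact.out : 0 < l) n
  let x : lp (fun _ : ℕ => ℂ) 2 := ⟨fun n => a n / (√(kernelCoeff l n) : ℂ), by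
    refine (memℓp_gen_iff (by simp)).2 (ha.congr fun n => ?_)
    simp only [norm_div, Complex.norm_real, Real.norm_eq_abs, ENNReal.toReal_ofNat, Real.rpow_two,
      div_pow, sq_abs, Real.sq_sqrt (hc n).le]⟩
  refine ⟨(isometryLp l).symm x, funext fun n => ?_⟩
  have := (Real.sqrt_pos.mpr (hc n)).ne'
  rw [coeff, LinearIsometryEquiv.apply_symm_apply]
  exact mul_div_cancel₀ _ (by exact_mod_cast this)

/-- A sequence whose weighted squares are dominated by a summable sequence is the coefficient
sequence of an element whose norm is controlled. -/
theorem exists_coeff_eq_of_le {a : ℕ → ℂ} {u : ℕ → ℝ} {s : ℝ} (hu : HasSum u s)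
    (hau : ∀ n, ‖a n‖ ^ 2 / kernelCoeff l n ≤ u n) :
    ∃ f : BergmanSpace l, coeff f = a ∧ ‖f‖ ^ 2 ≤ s := by
  obtain ⟨f, rfl⟩ := exists_coeff_eq (Summable.of_nonneg_of_le (fun n =>
    div_nonneg (sq_nonneg _) (kernelCoeff_pos (Fact.out : 0 < l) n).le) hau hu.summable)
  exact ⟨f, rfl, hasSum_le hau (hasSum_norm_coeff f) hu⟩

end BergmanSpace

/-! ### Multiplication and differentiation on the Bergman spaces -/

namespace BergmanSpace

variable {l l' : ℝ} [Fact (0 < l)] [Fact (0 < l')]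

theorem coeff_add (f g : BergmanSpace l) : coeff (f + g) = coeff f + coeff g := by
  funext n
  simp [coeff, mul_add]

theorem coeff_smul (c : ℂ) (f : BergmanSpace l) : coeff (c • f) = c • coeff f := by
  funext n
  simp [coeff, mul_left_comm]

theorem coeff_injective : Function.Injective (coeff : BergmanSpace l → ℕ → ℂ) := by
  intro f g h
  ext z
  exact (hasSum_coeff f z).unique (h ▸ hasSum_coeff g z)

/-- A linear map of coefficient sequences that is bounded for the norms of two Bergman spaces is a
bounded operator between them. -/
theorem exists_continuousLinearMap (T : (ℕ → ℂ) →ₗ[ℂ] (ℕ → ℂ)) (C : ℝ)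
    (h : ∀ f : BergmanSpace l, ∃ g : BergmanSpace l',
      coeff g = T (coeff f) ∧ ‖g‖ ^ 2 ≤ C * ‖f‖ ^ 2) :
    ∃ G : BergmanSpace l →L[ℂ] BergmanSpace l', ∀ f, coeff (G f) = T (coeff f) := by
  choose G hG hn using h
  let G' : BergmanSpace l →ₗ[ℂ] BergmanSpace l' :=
    { toFun := G
      map_add' := fun f g => coeff_injective (by rw [hG, coeff_add, coeff_add, hG, hG, map_add])
      map_smul' := fun c f => coeff_injective (by
        rw [hG, coeff_smul, map_smul, RingHom.id_apply, coeff_smul, hG]) }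
  refine ⟨G'.mkContinuous √C fun f => ?_, hG⟩
  have h1 := Real.sqrt_le_sqrt (hn f)
  rwa [Real.sqrt_sq (norm_nonneg _), Real.sqrt_mul' _ (sq_nonneg _),
    Real.sqrt_sq (norm_nonneg _)] at h1

/-- The sequence `(0, a 0, a 1, …)`. -/
def shiftRight : (ℕ → ℂ) →ₗ[ℂ] (ℕ → ℂ) where
  toFun a n := Nat.casesOn n 0 a
  map_add' a b := by funext n; cases n <;> simp
  map_smul' c a := by funext n; cases n <;> simp

variable (l) in
theorem exists_mulOp : ∃ G : BergmanSpace l →L[ℂ] BergmanSpace l,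
    ∀ f, coeff (G f) = shiftRight (coeff f) := by
  refine exists_continuousLinearMap _ (max 1 (1 / (2 * l))) fun f => ?_
  have hl : 0 < l := Fact.out
  refine exists_coeff_eq_of_le
    (u := fun n => Nat.casesOn n 0 fun k =>
      max 1 (1 / (2 * l)) * (‖coeff f k‖ ^ 2 / kernelCoeff l k)) ?_ fun n => ?_
  · rw [← hasSum_nat_add_iff' 1]
    simpa using (hasSum_norm_coeff f).mul_left (max 1 (1 / (2 * l)))
  · cases n with
    | zero => simp [shiftRight]
    | succ k =>
      have h0 := kernelCoeff_pos hl k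
      have h1 := kernelCoeff_pos hl (k + 1)
      have h2 := kernelCoeff_le_succ hl k
      simp only [shiftRight, LinearMap.coe_mk, AddHom.coe_mk]
      rw [← mul_div_assoc, div_le_div_iff₀ h1 h0]
      nlinarith [mul_le_mul_of_nonneg_left h2 (sq_nonneg ‖coeff f k‖)]

variable (l) in
/-- Multiplication by the coordinate on `𝔸^(l)`. -/
noncomputable def mulOp : BergmanSpace l →L[ℂ] BergmanSpace l := (exists_mulOp l).choose

theorem coeff_mulOp_succ (f : BergmanSpace l) (n : ℕ) : coeff (mulOp l f) (n + 1) = coeff f n := by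
  rw [mulOp, (exists_mulOp l).choose_spec f]
  rfl

theorem coeff_mulOp_zero (f : BergmanSpace l) : coeff (mulOp l f) 0 = 0 := by
  rw [mulOp, (exists_mulOp l).choose_spec f]
  rfl

theorem mulOp_apply (f : BergmanSpace l) (z : 𝔻) : mulOp l f z = z * f z := by
  have h := hasSum_coeff (mulOp l f) z
  rw [← hasSum_nat_add_iff' 1] at h
  simp only [Finset.range_one, Finset.sum_singleton, coeff_mulOp_zero, zero_mul, sub_zero,
    coeff_mulOp_succ] at h
  refine h.unique (((hasSum_coeff f z).mul_left (z : ℂ)).congr_fun fun n => ?_)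
  ring

/-- An element of `𝔸^(l)` that vanishes at the origin is divisible by the coordinate. -/
theorem exists_mulOp_eq {f : BergmanSpace l} (hf : f 0 = 0) : ∃ g, mulOp l g = f := by
  have hl : 0 < l := Fact.out
  obtain ⟨g, hg⟩ := exists_coeff_eq (l := l) (a := fun n => coeff f (n + 1)) (by
    have h := (summable_nat_add_iff 1).2 (hasSum_norm_coeff f).summable
    refine Summable.of_nonneg_of_le (fun n => div_nonneg (sq_nonneg _) (kernelCoeff_pos hl n).le)
      (fun n => ?_) (h.mul_left (max 1 (2 * l)))
    have h0 := kernelCoeff_pos hl n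
    have h1 := kernelCoeff_pos hl (n + 1)
    rw [← mul_div_assoc, div_le_div_iff₀ h0 h1]
    nlinarith [mul_le_mul_of_nonneg_left (kernelCoeff_succ_le hl n)
      (sq_nonneg ‖coeff f (n + 1)‖)])
  refine ⟨g, coeff_injective (funext fun n => ?_)⟩
  cases n with
  | zero => rw [coeff_mulOp_zero, coeff_zero_eq, hf]
  | succ n => rw [coeff_mulOp_succ, hg]

theorem coeff_mulOp_pow (f : BergmanSpace l) (n : ℕ) : coeff ((mulOp l ^ n) f) n = f 0 := by
  induction n with
  | zero => rw [← coeff_zero_eq]; rfl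
  | succ n ih => rw [pow_succ', mul_apply_eq_comp, coeff_mulOp_succ, ih]

/-- The norm of `z ^ n f` is at least that of its lowest order term `f 0 z ^ n`. -/
theorem norm_apply_zero_sq_le (f : BergmanSpace l) (n : ℕ) :
    ‖f 0‖ ^ 2 / kernelCoeff l n ≤ ‖(mulOp l ^ n) f‖ ^ 2 := by
  rw [← coeff_mulOp_pow f n]
  exact norm_coeff_sq_le _ n

variable (l) in
theorem exists_one : ∃ f : BergmanSpace l, coeff f = Pi.single 0 1 :=
  exists_coeff_eq (summable_of_ne_finset_zero (s := {0}) fun n hn => by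
    rw [Pi.single_eq_of_ne (by simpa using hn)]; simp)

variable (l) in
/-- The constant function `1` as an element of `𝔸^(l)`. -/
noncomputable def one : BergmanSpace l := (exists_one l).choose

theorem coeff_one : coeff (one l) = Pi.single 0 1 := (exists_one l).choose_spec

theorem one_apply_zero : one l 0 = 1 := by
  rw [← coeff_zero_eq, coeff_one, Pi.single_eq_same]

theorem coeff_mulOp_pow_one (n : ℕ) : coeff ((mulOp l ^ n) (one l)) = Pi.single n 1 := by
  induction n with
  | zero => exact coeff_one
  | succ n ih =>
    funext k
    rw [pow_succ', mul_apply_eq_comp]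
    cases k with
    | zero => rw [coeff_mulOp_zero, Pi.single_eq_of_ne (by omega)]
    | succ k => rw [coeff_mulOp_succ, ih]; simp [Pi.single_apply]

theorem norm_mulOp_pow_one (n : ℕ) :
    ‖(mulOp l ^ n) (one l)‖ ^ 2 = 1 / kernelCoeff l n := by
  have h := hasSum_norm_coeff ((mulOp l ^ n) (one l))
  rw [coeff_mulOp_pow_one] at h
  refine h.unique ?_
  have := hasSum_single (f := fun k => ‖(Pi.single n 1 : ℕ → ℂ) k‖ ^ 2 / kernelCoeff l k) n
    fun k hk => by rw [Pi.single_eq_of_ne hk]; simp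
  simpa using this

/-- The sequence of Taylor coefficients of the derivative. -/
def derivCoeff : (ℕ → ℂ) →ₗ[ℂ] (ℕ → ℂ) where
  toFun a n := (n + 1) * a (n + 1)
  map_add' a b := by funext n; simp [mul_add]
  map_smul' c a := by funext n; simp [mul_left_comm]

theorem hasSum_deriv (f : BergmanSpace l) (z : 𝔻) :
    HasSum (fun n => derivCoeff (coeff f) n * (z : ℂ) ^ n) (deriv (extendDisc f) z) := by
  obtain ⟨r, hzr, hr⟩ := exists_between z.norm_lt_one
  have hr0 : 0 ≤ r := (norm_nonneg _).trans hzr.le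
  have hu : Summable fun n => ‖coeff f n‖ * r ^ n := by
    have := (hasSum_coeff f (.mk (r : ℂ) (by simpa [abs_of_nonneg hr0] using hr))).summable.norm
    simpa [abs_of_nonneg hr0] using this
  have h := Complex.hasSum_deriv_of_summable_norm (U := Metric.ball 0 r) (z := (z : ℂ))
    (F := fun n w => coeff f n * w ^ n) hu (fun n => by fun_prop) Metric.isOpen_ball
    (fun n w hw => by
      have hw' : ‖w‖ ≤ r := by simpa using (mem_ball_zero_iff.1 hw).le
      rw [norm_mul, norm_pow]
      gcongr) (by simpa using hzr)
  have e : (fun w => ∑' n, coeff f n * w ^ n) =ᶠ[nhds (z : ℂ)] extendDisc f := by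
    filter_upwards [Metric.isOpen_ball.mem_nhds
      (show (z : ℂ) ∈ Metric.ball 0 1 by simpa using z.norm_lt_one)] with w hw
    obtain ⟨w, rfl⟩ : ∃ w' : 𝔻, (w' : ℂ) = w := ⟨.mk w (by simpa using hw), rfl⟩
    rw [extendDisc_coe, (hasSum_coeff f w).tsum_eq]
  rw [e.deriv_eq, ← hasSum_nat_add_iff' 1] at h
  have h0 : deriv (fun w : ℂ => coeff f 0 * w ^ 0) z = 0 := by simp
  rw [Finset.range_one, Finset.sum_singleton, h0, sub_zero] at h
  refine h.congr_fun fun n => ?_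
  rw [deriv_const_mul_field, deriv_pow_field]
  simp only [derivCoeff, LinearMap.coe_mk, AddHom.coe_mk]
  push_cast
  ring

variable (l) in
/-- Differentiation is bounded from `𝔸^(l)` to `𝔸^(l+1)`. -/
theorem exists_derivOp [Fact (0 < l + 1)] : ∃ D : BergmanSpace l →L[ℂ] BergmanSpace (l + 1),
    ∀ f z, D f z = deriv (extendDisc f) (z : ℂ) := by
  have hl : 0 < l := Fact.out
  obtain ⟨D, hD⟩ := exists_continuousLinearMap (l := l) (l' := l + 1) derivCoeff
    (2 * l * (2 * l + 1)) fun f => by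
      have h := (hasSum_norm_coeff f).mul_left (2 * l * (2 * l + 1))
      rw [← hasSum_nat_add_iff' 1] at h
      obtain ⟨g, hg, hn⟩ := exists_coeff_eq_of_le (l := l + 1) (a := derivCoeff (coeff f)) h
        fun n => by
          have h0 := kernelCoeff_pos (Fact.out : 0 < l + 1) n
          have h1 := kernelCoeff_pos hl (n + 1)
          have e : ‖derivCoeff (coeff f) n‖ = (n + 1) * ‖coeff f (n + 1)‖ := by
            simp only [derivCoeff, LinearMap.coe_mk, AddHom.coe_mk, norm_mul]
            norm_cast
          rw [e, ← mul_div_assoc, div_le_div_iff₀ h0 h1]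
          nlinarith [mul_le_mul_of_nonneg_left (sq_mul_kernelCoeff_succ_le hl n)
            (sq_nonneg ‖coeff f (n + 1)‖)]
      refine ⟨g, hg, hn.trans (sub_le_self _ ?_)⟩
      have := kernelCoeff_pos hl 0
      simp only [Finset.range_one, Finset.sum_singleton]
      positivity
  refine ⟨D, fun f z => (hasSum_coeff (D f) z).unique ?_⟩
  rw [hD]
  exact hasSum_deriv f z

/-- The `k`-th derivative is bounded from `𝔸^(l)` to `𝔸^(l+k)`. -/
theorem exists_iteratedDerivOp (k : ℕ) : ∀ (l l' : ℝ) [Fact (0 < l)] [Fact (0 < l')], l' = l + k →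
    ∃ D : BergmanSpace l →L[ℂ] BergmanSpace l',
      ∀ f z, D f z = iteratedDeriv k (extendDisc f) (z : ℂ) := by
  induction k with
  | zero =>
    intro l l' _ _ h
    obtain rfl : l' = l := by simpa using h
    exact ⟨ContinuousLinearMap.id ℂ _, fun f z => by simp [extendDisc_coe]⟩
  | succ k ih =>
    intro l l' i _ h
    have : Fact (0 < l + 1) := ⟨add_pos i.out one_pos⟩
    obtain ⟨D, hD⟩ := exists_derivOp l
    obtain ⟨E, hE⟩ := ih (l + 1) l' (by rw [h]; push_cast; ring)
    refine ⟨E.comp D, fun f z => ?_⟩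
    rw [ContinuousLinearMap.comp_apply, hE, iteratedDeriv_succ']
    refine Filter.EventuallyEq.iteratedDeriv_eq k ?_
    filter_upwards [Metric.isOpen_ball.mem_nhds
      (show (z : ℂ) ∈ Metric.ball 0 1 by simpa using z.norm_lt_one)] with w hw
    obtain ⟨w, rfl⟩ : ∃ w' : 𝔻, (w' : ℂ) = w := ⟨.mk w (by simpa using hw), rfl⟩
    rw [extendDisc_coe, hD]

end BergmanSpace

/-! ### Removing the matrix `Y` -/

section

variable (η : ℝ) [Fact (0 < η)] {m : ℕ} (d : Fin (m + 1) → ℕ)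

/-- Multiplication by the coordinate in every component of `𝐀^(η)`. -/
noncomputable def sumMulOp : SumBergmanSpace η d →L[ℂ] SumBergmanSpace η d :=
  (PiLp.continuousLinearEquiv 2 ℂ fun p : BlockIndex d =>
    BergmanSpace (η + ((p.1 : ℕ) : ℝ))).symm.toContinuousLinearMap.comp
    (ContinuousLinearMap.pi fun p => (BergmanSpace.mulOp _).comp (PiLp.proj 2 _ p))

variable {η d}

theorem sumMulOp_apply (f : SumBergmanSpace η d) (p : BlockIndex d) :
    sumMulOp η d f p = BergmanSpace.mulOp _ (f p) := rfl

theorem sumMulOp_pow_apply (n : ℕ) (f : SumBergmanSpace η d) (p : BlockIndex d) :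
    (sumMulOp η d ^ n) f p = (BergmanSpace.mulOp _ ^ n) (f p) := by
  induction n with
  | zero => rfl
  | succ n ih =>
    rw [pow_succ', pow_succ', mul_apply_eq_comp, mul_apply_eq_comp, sumMulOp_apply, ih]

/-- An operator on `𝐀^(η)` that maps each component to components of strictly larger block number
is nilpotent. -/
theorem pow_apply_eq_zero_of_strictly_lower (N : SumBergmanSpace η d →L[ℂ] SumBergmanSpace η d)
    (hN : ∀ f p, (∀ q : BlockIndex d, q.1 < p.1 → f q = 0) → N f p = 0) (k : ℕ) :
    ∀ (f : SumBergmanSpace η d) (p : BlockIndex d), (p.1 : ℕ) < k → (N ^ k) f p = 0 := by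
  induction k with
  | zero => intro f p hp; omega
  | succ k ih =>
    intro f p hp
    rw [pow_succ', mul_apply_eq_comp]
    refine hN _ _ fun q hq => ih f q ?_
    have : (q.1 : ℕ) < p.1 := hq
    omega

variable (η) (Y : Matrix (BlockIndex d) (BlockIndex d) ℂ)

/-- Since the `k`-th derivative maps `𝔸^(η+j)` into `𝔸^(η+j+k)`, the components of `Γ^(η,Y) f` with
the diagonal term left out lie in the same Bergman spaces as those of `f`. -/
theorem exists_gamma_sub_id : ∃ N : SumBergmanSpace η d →L[ℂ] SumBergmanSpace η d,
    (∀ f p z, N f p z + f p z = gamma η Y f z p) ∧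
    (∀ f p, (∀ q : BlockIndex d, q.1 < p.1 → f q = 0) → N f p = 0) := by
  have hD : ∀ p q : BlockIndex d, q.1 ≤ p.1 →
      ∃ D : BergmanSpace (η + ((q.1 : ℕ) : ℝ)) →L[ℂ] BergmanSpace (η + ((p.1 : ℕ) : ℝ)),
        ∀ f z, D f z = iteratedDeriv ((p.1 : ℕ) - (q.1 : ℕ)) (extendDisc f) (z : ℂ) := by
    intro p q hqp
    refine BergmanSpace.exists_iteratedDerivOp _ _ _ ?_
    have : (q.1 : ℕ) ≤ p.1 := hqp
    push_cast [this]
    ring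
  choose! D hD using hD
  let c : BlockIndex d → BlockIndex d → ℂ := fun p q =>
    (1 / (((p.1 : ℕ) - (q.1 : ℕ)).factorial : ℂ)) *
      (1 / (ascPochhammer ℂ ((p.1 : ℕ) - (q.1 : ℕ))).eval (2 * (η : ℂ) + 2 * ((q.1 : ℕ) : ℂ))) *
      (Y ^ ((p.1 : ℕ) - (q.1 : ℕ))) p q
  let N : SumBergmanSpace η d →L[ℂ] SumBergmanSpace η d :=
    (PiLp.continuousLinearEquiv 2 ℂ fun p : BlockIndex d =>
      BergmanSpace (η + ((p.1 : ℕ) : ℝ))).symm.toContinuousLinearMap.comp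
      (ContinuousLinearMap.pi fun p => ∑ q ∈ Finset.univ.filter fun q : BlockIndex d => q.1 < p.1,
        c p q • (D p q).comp (PiLp.proj 2 _ q))
  have hN : ∀ f p, N f p = ∑ q ∈ Finset.univ.filter fun q : BlockIndex d => q.1 < p.1,
      c p q • D p q (f q) := fun f p => by
    change (∑ q ∈ Finset.univ.filter fun q : BlockIndex d => q.1 < p.1,
        c p q • (D p q).comp (PiLp.proj 2 _ q)) f = _
    rw [sum_apply]
    rfl
  refine ⟨N, fun f p z => ?_, fun f p hf => ?_⟩
  · have hz : N f p z = ∑ q ∈ Finset.univ.filter fun q : BlockIndex d => q.1 < p.1,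
        c p q * iteratedDeriv ((p.1 : ℕ) - (q.1 : ℕ)) (extendDisc (f q)) (z : ℂ) := by
      rw [hN]
      let ev : BergmanSpace (η + ((p.1 : ℕ) : ℝ)) →ₗ[ℂ] ℂ :=
        (LinearMap.proj z).comp (RKHS.coeCLM ℂ (H := BergmanSpace (η + ((p.1 : ℕ) : ℝ)))).toLinearMap
      change ev _ = _
      rw [map_sum]
      refine Finset.sum_congr rfl fun q hq => ?_
      rw [map_smul, smul_eq_mul]
      congr 1
      exact hD p q (Finset.mem_filter.1 hq).2.le (f q) z
    rw [hz]
    change _ = ∑ q : BlockIndex d, if q.1 ≤ p.1 then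
      c p q * iteratedDeriv ((p.1 : ℕ) - (q.1 : ℕ)) (extendDisc (f q)) (z : ℂ) else 0
    have hp : f p z = ∑ q : BlockIndex d, if q = p then f q z else 0 := by simp
    rw [hp, Finset.sum_filter, ← Finset.sum_add_distrib]
    refine Finset.sum_congr rfl fun q _ => ?_
    rcases lt_trichotomy q.1 p.1 with h | h | h
    · rw [if_pos h, if_neg (by rintro rfl; exact h.ne rfl), if_pos h.le, add_zero]
    · -- inside a diagonal block `Y ^ 0 = 1` leaves `f p` alone
      rw [if_neg h.not_lt, if_pos h.le, zero_add]
      simp only [c, h, Nat.sub_self, pow_zero, iteratedDeriv_zero, extendDisc_coe,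
        Matrix.one_apply, eq_comm (a := p)]
      split_ifs <;> simp
    · rw [if_neg h.not_gt, if_neg (by rintro rfl; exact h.ne rfl), if_neg h.not_ge, add_zero]
  · rw [hN]
    refine Finset.sum_eq_zero fun q hq => ?_
    rw [hf q (Finset.mem_filter.1 hq).2, map_zero, smul_zero]

/-- `H_I^(η,Y)` and `𝐀^(η)` consist of the same functions, and their norms are equivalent. -/
theorem exists_sectionSpace_equiv : ∃ E : SectionSpace η Y ≃L[ℂ] SumBergmanSpace η d,
    ∀ F p z, E F p z = F z p := by
  obtain ⟨N, hN, hlow⟩ := exists_gamma_sub_id η Y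
  have hnil : IsNilpotent N := ⟨m + 1, by
    ext1 f
    ext1 p
    exact pow_apply_eq_zero_of_strictly_lower N hlow (m + 1) f p p.1.2⟩
  obtain ⟨u, hu⟩ := hnil.isUnit_one_add
  refine ⟨(SectionSpace.isometryEquiv η Y).symm.toContinuousLinearEquiv.trans
    (ContinuousLinearEquiv.ofUnit u), fun F p z => ?_⟩
  obtain ⟨f, rfl⟩ := (SectionSpace.isometryEquiv η Y).surjective F
  have h1 : ((SectionSpace.isometryEquiv η Y).symm.toContinuousLinearEquiv.trans
      (ContinuousLinearEquiv.ofUnit u)) (SectionSpace.isometryEquiv η Y f) = f + N f := by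
    change (u : SumBergmanSpace η d →L[ℂ] SumBergmanSpace η d)
      ((SectionSpace.isometryEquiv η Y).symm (SectionSpace.isometryEquiv η Y f)) = _
    rw [hu, LinearIsometryEquiv.symm_apply_apply]
    rfl
  rw [h1, PiLp.add_apply, RKHS.coe_add, Pi.add_apply, add_comm, hN]
  rfl

/-- Multiplication by the coordinate on `H_I^(η,Y)` is bounded, and similar to the direct sum of the
multiplications on the spaces `𝔸^(η+j)`, whatever `Y` is. -/
theorem exists_isMulOp_similar : ∃ (E : SectionSpace η Y ≃L[ℂ] SumBergmanSpace η d)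
    (M : SectionSpace η Y →L[ℂ] SectionSpace η Y), SectionSpace.IsMulOp M ∧
      ∀ F, E (M F) = sumMulOp η d (E F) := by
  obtain ⟨E, hE⟩ := exists_sectionSpace_equiv η Y
  refine ⟨E, (E.symm : SumBergmanSpace η d →L[ℂ] SectionSpace η Y).comp
    ((sumMulOp η d).comp (E : SectionSpace η Y →L[ℂ] SumBergmanSpace η d)), fun F z => ?_,
    fun F => E.apply_symm_apply _⟩
  ext p
  rw [← hE]
  simp only [ContinuousLinearMap.comp_apply, ContinuousLinearEquiv.coe_coe,
    E.apply_symm_apply]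
  rw [sumMulOp_apply, BergmanSpace.mulOp_apply, hE]
  rfl

end

/-! ### Similarity invariants of the direct sum of shifts -/

theorem card_blockIndex_eq {m : ℕ} (η : ℝ) (d : Fin (m + 1) → ℕ) (j : Fin (m + 1)) :
    Fintype.card {q : BlockIndex d // η + ((q.1 : ℕ) : ℝ) = η + ((j : ℕ) : ℝ)} = d j := by
  rw [← Fintype.card_fin (d j)]
  refine Fintype.card_congr
    ((Equiv.subtypeEquivRight fun q => ?_).trans (Equiv.sigmaSubtype (β := fun j => Fin (d j)) j))
  simp [Fin.ext_iff]

theorem exists_index_eq_of_card_eq {η η' : ℝ} {m m' : ℕ} {d : Fin (m + 1) → ℕ}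
    {d' : Fin (m' + 1) → ℕ} (hd : ∀ j, 0 < d j)
    (h : ∀ t, Fintype.card {q : BlockIndex d // η + ((q.1 : ℕ) : ℝ) = t} =
      Fintype.card {p : BlockIndex d' // η' + ((p.1 : ℕ) : ℝ) = t}) (j : Fin (m + 1)) :
    ∃ p : Fin (m' + 1), η' + ((p : ℕ) : ℝ) = η + ((j : ℕ) : ℝ) := by
  have h1 := h (η + ((j : ℕ) : ℝ))
  rw [card_blockIndex_eq] at h1
  obtain ⟨p⟩ := Fintype.card_pos_iff.1 (h1 ▸ hd j)
  exact ⟨p.1.1, p.2⟩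

section

variable {η η' : ℝ} [Fact (0 < η)] [Fact (0 < η')] {m m' : ℕ}
  {d : Fin (m + 1) → ℕ} {d' : Fin (m' + 1) → ℕ}

variable (η d) in
/-- The constant function with value `v`, as an element of `𝐀^(η)`. -/
noncomputable def constFun : (BlockIndex d → ℂ) →ₗ[ℂ] SumBergmanSpace η d where
  toFun v := WithLp.toLp 2 fun p => v p • BergmanSpace.one _
  map_add' v w := by ext1 p; simp [add_smul]
  map_smul' c v := by ext1 p; simp [mul_smul]

theorem constFun_apply (v : BlockIndex d → ℂ) (p : BlockIndex d) :
    constFun η d v p = v p • BergmanSpace.one _ := rfl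

variable (η d) in
/-- Evaluation of the elements of `𝐀^(η)` at the origin. -/
noncomputable def evalZero : SumBergmanSpace η d →ₗ[ℂ] (BlockIndex d → ℂ) where
  toFun f p := f p 0
  map_add' f g := by funext p; simp
  map_smul' c f := by funext p; simp

theorem evalZero_constFun (v : BlockIndex d → ℂ) : evalZero η d (constFun η d v) = v := by
  funext p
  simp [evalZero, constFun_apply, BergmanSpace.one_apply_zero]

theorem evalZero_sumMulOp (f : SumBergmanSpace η d) : evalZero η d (sumMulOp η d f) = 0 := by
  funext p
  simp [evalZero, sumMulOp_apply, BergmanSpace.mulOp_apply]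

theorem exists_sumMulOp_eq {f : SumBergmanSpace η d} (hf : evalZero η d f = 0) :
    ∃ g, sumMulOp η d g = f := by
  choose g hg using fun p => BergmanSpace.exists_mulOp_eq (f := f p) (congrFun hf p)
  exact ⟨WithLp.toLp 2 g, by ext1 p; exact hg p⟩

theorem norm_sumMulOp_pow_constFun_single (q : BlockIndex d) (n : ℕ) :
    ‖(sumMulOp η d ^ n) (constFun η d (Pi.single q 1))‖ ^ 2 =
      1 / kernelCoeff (η + ((q.1 : ℕ) : ℝ)) n := by
  rw [PiLp.norm_sq_eq_of_L2, Finset.sum_eq_single q]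
  · rw [sumMulOp_pow_apply, constFun_apply, Pi.single_eq_same, one_smul,
      BergmanSpace.norm_mulOp_pow_one]
  · intro p _ hp
    rw [sumMulOp_pow_apply, constFun_apply, Pi.single_eq_of_ne hp, zero_smul, map_zero,
      norm_zero]
    simp
  · simp

/-- The matrix of `v ↦ (L v)(0)`, with `v` a constant function. If `L` commutes with multiplication by
the coordinate, then `L` is multiplication by a matrix function, and this is its value at `0`. -/
noncomputable def symbolZero (L : SumBergmanSpace η d →L[ℂ] SumBergmanSpace η' d') :
    (BlockIndex d → ℂ) →ₗ[ℂ] (BlockIndex d' → ℂ) :=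
  evalZero η' d' ∘ₗ L.toLinearMap ∘ₗ constFun η d

/-- If the image under `L` of a constant function vanishes at the origin, it is divisible by the
coordinate, and hence so is the constant function. -/
theorem symbolZero_injective (L : SumBergmanSpace η d ≃L[ℂ] SumBergmanSpace η' d')
    (hL : ∀ f, L (sumMulOp η d f) = sumMulOp η' d' (L f)) :
    Function.Injective (symbolZero (L : SumBergmanSpace η d →L[ℂ] SumBergmanSpace η' d')) := by
  rw [← LinearMap.ker_eq_bot, LinearMap.ker_eq_bot']
  intro v hv
  obtain ⟨g, hg⟩ := exists_sumMulOp_eq (f := L (constFun η d v)) hv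
  have h : sumMulOp η d (L.symm g) = constFun η d v := by
    apply L.injective
    rw [hL, L.apply_symm_apply, hg]
  rw [← evalZero_constFun (η := η) v, ← h, evalZero_sumMulOp]

/-- There is no nonzero multiplier from `𝔸^(λ)` to `𝔸^(μ)` for `μ < λ`: the norms of the monomials
`z ^ n` decay too slowly in `𝔸^(μ)`. -/
theorem symbolZero_single_eq_zero (L : SumBergmanSpace η d →L[ℂ] SumBergmanSpace η' d')
    (hL : ∀ f, L (sumMulOp η d f) = sumMulOp η' d' (L f)) (q : BlockIndex d) (p : BlockIndex d')
    (h : η' + ((p.1 : ℕ) : ℝ) < η + ((q.1 : ℕ) : ℝ)) : symbolZero L (Pi.single q 1) p = 0 := by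
  have hpow : ∀ n f, L ((sumMulOp η d ^ n) f) = (sumMulOp η' d' ^ n) (L f) := by
    intro n
    induction n with
    | zero => intro f; rfl
    | succ n ih =>
      intro f
      rw [pow_succ', pow_succ', mul_apply_eq_comp, mul_apply_eq_comp, hL, ih]
  have hq : 0 < η + ((q.1 : ℕ) : ℝ) := Fact.out
  have hp : 0 < η' + ((p.1 : ℕ) : ℝ) := Fact.out
  set x := constFun η d (Pi.single q 1) with hx
  have key : ∀ n, ‖symbolZero L (Pi.single q 1) p‖ ^ 2 ≤ ‖L‖ ^ 2 *
      (kernelCoeff (η' + ((p.1 : ℕ) : ℝ)) n / kernelCoeff (η + ((q.1 : ℕ) : ℝ)) n) := by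
    intro n
    have hc := kernelCoeff_pos hp n
    have h1 : ‖symbolZero L (Pi.single q 1) p‖ ^ 2 / kernelCoeff (η' + ((p.1 : ℕ) : ℝ)) n ≤
        ‖(BergmanSpace.mulOp _ ^ n) (L x p)‖ ^ 2 :=
      BergmanSpace.norm_apply_zero_sq_le (L x p) n
    have h2 : ‖(BergmanSpace.mulOp _ ^ n) (L x p)‖ ≤ ‖L‖ * ‖(sumMulOp η d ^ n) x‖ := by
      rw [← sumMulOp_pow_apply, ← hpow]
      exact (PiLp.norm_apply_le _ p).trans (L.le_opNorm _)
    have h3 := pow_le_pow_left₀ (norm_nonneg _) h2 2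
    rw [mul_pow, hx, norm_sumMulOp_pow_constFun_single] at h3
    have h4 := (div_le_iff₀ hc).1 (h1.trans h3)
    calc _ ≤ _ := h4
      _ = _ := by ring
  have hlim := ((tendsto_kernelCoeff_div hq hp h).const_mul (‖L‖ ^ 2))
  rw [mul_zero] at hlim
  have h0 := ge_of_tendsto' hlim fun n => key (n + 1)
  have h1 := le_antisymm h0 (sq_nonneg _)
  simpa using h1

/-- The number of components of `𝐀^(η)` with parameter in an upper set does not decrease under an
invertible intertwining operator, since its value at the origin is injective and triangular. -/
theorem card_le_card_of_intertwining (L : SumBergmanSpace η d ≃L[ℂ] SumBergmanSpace η' d')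
    (hL : ∀ f, L (sumMulOp η d f) = sumMulOp η' d' (L f)) (P : ℝ → Prop) [DecidablePred P]
    (hP : ∀ s t, P s → s ≤ t → P t) :
    Fintype.card {q : BlockIndex d // P (η + ((q.1 : ℕ) : ℝ))} ≤
      Fintype.card {p : BlockIndex d' // P (η' + ((p.1 : ℕ) : ℝ))} := by
  set Φ := symbolZero (L : SumBergmanSpace η d →L[ℂ] SumBergmanSpace η' d') with hΦ
  let i : ({q : BlockIndex d // P (η + ((q.1 : ℕ) : ℝ))} → ℂ) →ₗ[ℂ] (BlockIndex d → ℂ) :=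
    Function.ExtendByZero.linearMap ℂ Subtype.val
  let r : (BlockIndex d' → ℂ) →ₗ[ℂ] ({p : BlockIndex d' // P (η' + ((p.1 : ℕ) : ℝ))} → ℂ) :=
    LinearMap.funLeft ℂ ℂ Subtype.val
  have hi : ∀ v q, i v q.1 = v q := fun v q => Subtype.val_injective.extend_apply v 0 q
  have hi0 : ∀ v q, ¬ P (η + ((q.1 : ℕ) : ℝ)) → i v q = 0 := fun v q hq =>
    Function.extend_apply' (f := Subtype.val) v 0 q (by rintro ⟨q', rfl⟩; exact hq q'.2)
  have hzero : ∀ v p, ¬ P (η' + ((p.1 : ℕ) : ℝ)) → Φ (i v) p = 0 := by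
    intro v p hp
    rw [← Finset.univ_sum_single (i v), map_sum, Finset.sum_apply]
    refine Finset.sum_eq_zero fun q _ => ?_
    by_cases hq : P (η + ((q.1 : ℕ) : ℝ))
    · have hlt : η' + ((p.1 : ℕ) : ℝ) < η + ((q.1 : ℕ) : ℝ) :=
        not_le.1 fun hle => hp (hP _ _ hq hle)
      rw [show (Pi.single q (i v q) : BlockIndex d → ℂ) = i v q • Pi.single q 1 by
        rw [← Pi.single_smul, smul_eq_mul, mul_one], map_smul, Pi.smul_apply, hΦ,
        symbolZero_single_eq_zero _ hL q p hlt, smul_zero]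
    · rw [hi0 v q hq, Pi.single_zero, map_zero, Pi.zero_apply]
  have hinj : Function.Injective (r ∘ₗ Φ ∘ₗ i) := by
    rw [← LinearMap.ker_eq_bot, LinearMap.ker_eq_bot']
    intro v hv
    have h1 : Φ (i v) = 0 := by
      funext p
      by_cases hp : P (η' + ((p.1 : ℕ) : ℝ))
      · exact congrFun hv ⟨p, hp⟩
      · exact hzero v p hp
    have h2 : i v = 0 := symbolZero_injective L hL (h1.trans (map_zero Φ).symm)
    funext q
    rw [← hi v q, h2]
    rfl
  simpa using LinearMap.finrank_le_finrank_of_injective hinj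

theorem card_eq_card_of_intertwining (L : SumBergmanSpace η d ≃L[ℂ] SumBergmanSpace η' d')
    (hL : ∀ f, L (sumMulOp η d f) = sumMulOp η' d' (L f)) (t : ℝ) :
    Fintype.card {q : BlockIndex d // η + ((q.1 : ℕ) : ℝ) = t} =
      Fintype.card {p : BlockIndex d' // η' + ((p.1 : ℕ) : ℝ) = t} := by
  classical
  have hL' : ∀ f, L.symm (sumMulOp η' d' f) = sumMulOp η d (L.symm f) := fun f => by
    rw [L.symm_apply_eq, hL, L.apply_symm_apply]
  have split : ∀ {η : ℝ} {m : ℕ} {d : Fin (m + 1) → ℕ},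
      Fintype.card {q : BlockIndex d // t ≤ η + ((q.1 : ℕ) : ℝ)} =
        Fintype.card {q : BlockIndex d // η + ((q.1 : ℕ) : ℝ) = t} +
        Fintype.card {q : BlockIndex d // t < η + ((q.1 : ℕ) : ℝ)} := by
    intro η m d
    rw [← Fintype.card_subtype_or_disjoint]
    · exact Fintype.card_congr (Equiv.subtypeEquivRight fun q => by
        rw [le_iff_eq_or_lt, eq_comm])
    · rw [Pi.disjoint_iff]
      intro q
      rw [Prop.disjoint_iff]
      rintro ⟨h, h'⟩
      exact h'.ne' h
  have h1 := card_le_card_of_intertwining L hL (fun s => t ≤ s) fun _ _ h h' => h.trans h'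
  have h2 := card_le_card_of_intertwining L.symm hL' (fun s => t ≤ s) fun _ _ h h' => h.trans h'
  have h3 := card_le_card_of_intertwining L hL (fun s => t < s) fun _ _ h h' => h.trans_le h'
  have h4 := card_le_card_of_intertwining L.symm hL' (fun s => t < s) fun _ _ h h' =>
    h.trans_le h'
  have h5 := split (η := η) (d := d)
  have h6 := split (η := η') (d := d')
  beta_reduce at h1 h2 h3 h4
  omega

/-- The direct sums of shifts are similar only if all their parameters agree. -/
theorem eq_of_intertwining (hd : ∀ j, 0 < d j) (hd' : ∀ j, 0 < d' j)
    (L : SumBergmanSpace η d ≃L[ℂ] SumBergmanSpace η' d')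
    (hL : ∀ f, L (sumMulOp η d f) = sumMulOp η' d' (L f)) :
    η = η' ∧ ∃ h : m = m', ∀ j : Fin (m + 1), d j = d' (Fin.cast (by rw [h]) j) := by
  have h := card_eq_card_of_intertwining L hL
  obtain ⟨p, hp⟩ := exists_index_eq_of_card_eq hd h 0
  obtain ⟨q, hq⟩ := exists_index_eq_of_card_eq hd' (fun t => (h t).symm) 0
  have hη : η = η' := by
    have := (p : ℕ).cast_nonneg (α := ℝ)
    have := (q : ℕ).cast_nonneg (α := ℝ)
    simp only [Fin.val_zero, Nat.cast_zero] at hp hq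
    linarith
  subst hη
  obtain ⟨p, hp⟩ := exists_index_eq_of_card_eq hd h (Fin.last m)
  obtain ⟨q, hq⟩ := exists_index_eq_of_card_eq hd' (fun t => (h t).symm) (Fin.last m')
  have hp' : (p : ℕ) = m := by simpa using hp
  have hq' : (q : ℕ) = m' := by simpa using hq
  obtain rfl : m = m' := by omega
  refine ⟨rfl, rfl, fun j => ?_⟩
  rw [← card_blockIndex_eq η d j, h, card_blockIndex_eq]
  rfl

end

end HomogeneousOperators

open HomogeneousOperators
theorem mainTheorem5
    (η η' : ℝ) [Fact (0 < η)] [Fact (0 < η')] (m m' : ℕ)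
    (d : Fin (m + 1) → ℕ) (d' : Fin (m' + 1) → ℕ) (hd : ∀ j, 0 < d j) (hd' : ∀ j, 0 < d' j)
    (Y : Matrix (BlockIndex d) (BlockIndex d) ℂ) (Y' : Matrix (BlockIndex d') (BlockIndex d') ℂ)
    (hY : IsBlockSubdiagonal Y) (hY' : IsBlockSubdiagonal Y') :
    ∃ (M : SectionSpace η Y →L[ℂ] SectionSpace η Y) (M' : SectionSpace η' Y' →L[ℂ] SectionSpace η' Y'),
      SectionSpace.IsMulOp M ∧ SectionSpace.IsMulOp M' ∧
      (AreSimilar M M' ↔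
        η = η' ∧ ∃ h : m = m', ∀ j : Fin (m + 1), d j = d' (Fin.cast (by rw [h]) j)) := by
  obtain ⟨E, M, hM, hE⟩ := exists_isMulOp_similar η Y
  obtain ⟨E', M', hM', hE'⟩ := exists_isMulOp_similar η' Y'
  have hE'' : ∀ f, E'.symm (sumMulOp η' d' f) = M' (E'.symm f) := fun f => by
    rw [E'.symm_apply_eq, hE', E'.apply_symm_apply]
  refine ⟨M, M', hM, hM', ?_, ?_⟩
  · rintro ⟨L, hL⟩
    refine eq_of_intertwining hd hd' ((E.symm.trans L).trans E') fun f => ?_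
    have hEs : E.symm (sumMulOp η d f) = M (E.symm f) := by
      rw [E.symm_apply_eq, hE, E.apply_symm_apply]
    simp only [ContinuousLinearEquiv.trans_apply, hEs, hL, hE']
  · rintro ⟨rfl, rfl, h⟩
    obtain rfl : d = d' := funext h
    refine ⟨E.trans E'.symm, fun f => ?_⟩
    simp only [ContinuousLinearEquiv.trans_apply, hE, hE'']
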